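/- Let $A$ be a finite-dimensional Hilbert space, let $\{p(x),\rho_x\}_{x\in X}$ be a finite ensemble of density operators on $A$, and let $\rho^{AR}=\sum_x p(x)\,\rho_x\otimes|x\rangle\langle x|$, where $\{|x\rangle\}_{x\in X}$ is an orthonormal basis of $R$. All logarithms are binary. For $\alpha>1$ put $S_\alpha(\sigma)=\frac{1}{1-\alpha}\log\operatorname{Tr}\sigma^\alpha$. For a bipartite state $\rho^{AR}$ the $\alpha$-Rényi entanglement of purification is $$E_{\alpha,p}(A:R)_\rho=\inf_{\mathcal N:B\to E}S_\alpha(AE)_\sigma,\qquad \sigma^{AE}=(\mathrm{id}_A\otimes\mathcal N)\big(\operatorname{Tr}_R|\psi\rangle\langle\psi|^{ABR}\big),$$ where $|\psi\rangle^{ABR}$ is a purification of $\rho^{AR}$ and the infimum is over all completely positive trace-preserving (CPTP) maps $\mathcal N$ from $B$ to a finite-dimensional system $E$ (its value does not depend on the purification). Its regularization is $$E^\infty_{\alpha,p}(A:R)_\rho=\lim_{n\to\infty}\tfrac1n E_{\alpha,p}(A^n:R^n)_{\rho^{\otimes n}}.$$ A visible compression scheme for $n$ copies consists of CPTP maps $\mathcal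 C:A^nC^n\to M$ and $\mathcal D:M\to A^n$, where $C$ is a copy of $R$ and $M$ is a finite-dimensional system. For $x^n=(x_1,\dots,x_n)$ write $p(x^n)=\prod_i p(x_i)$, $\rho_{x^n}=\bigotimes_i\rho_{x_i}$ and $\xi_{x^n}=\mathcal D\big(\mathcal C(\rho_{x^n}\otimes|x^n\rangle\langle x^n|^{C^n})\big)$. The rate of the scheme is $\frac1n\log|M|$, where $|M|=\dim M$, and its fidelity is $$\overline F_v=\sum_{x^n}p(x^n)\,F(\rho_{x^n},\xi_{x^n}),\qquad F(\rho,\xi)=\operatorname{Tr}\sqrt{\sqrt\rho\,\xi\sqrt\rho}.$$ Then the limit defining $E^\infty_{\alpha,p}(A:R)_\rho$ exists for every $\alpha>1$, the limit $\lim_{\alpha\to1^+}E^\infty_{\alpha,p}(A:R)_\rho$ exists and is finite, and for every real $Q_v<\lim_{\alpha\to1^+}E^\infty_{\alpha,p}(A:R)_\rho$ there is a constant $K>0$ (depending only on the ensemble and on $Q_v$) such that for every $n\ge1$ every visible compression scheme for $n$ copies with rate at most $Q_v$ satisfies $$\overline F_v\le 2^{-nK}.$$ -/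

import Mathlib

open Filter
open scoped Kronecker Topology ComplexOrder

noncomputable section

namespace VisibleCompression

/-- A density matrix on the Hilbert space `ℂ^I`. -/
def IsDensity {I : Type*} [Fintype I] (ρ : Matrix I I ℂ) : Prop :=
  ρ.PosSemidef ∧ ρ.trace = 1

/-- The map `id_K ⊗ Φ` on operators on `ℂ^K ⊗ ℂ^B`, block by block. -/
def idTensor (K : Type*) {B E : Type*} (Φ : Matrix B B ℂ →ₗ[ℂ] Matrix E E ℂ)
    (W : Matrix (K × B) (K × B) ℂ) : Matrix (K × E) (K × E) ℂ :=
  Matrix.of fun i j => Φ (Matrix.of fun b b' => W (i.1, b) (j.1, b')) i.2 j.2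

/-- A quantum channel: a completely positive and trace preserving linear map. -/
structure IsCPTP {B E : Type*} [Fintype B] [Fintype E]
    (Φ : Matrix B B ℂ →ₗ[ℂ] Matrix E E ℂ) : Prop where
  completelyPositive : ∀ (k : ℕ) (W : Matrix (Fin k × B) (Fin k × B) ℂ),
    W.PosSemidef → (idTensor (Fin k) Φ W).PosSemidef
  tracePreserving : ∀ W : Matrix B B ℂ, (Φ W).trace = W.trace

/-- The (square root) fidelity `F(ρ, ξ) = Tr √(√ρ ξ √ρ)`. -/
def fidelity {I : Type*} [Fintype I] [DecidableEq I] (ρ ξ : Matrix I I ℂ) : ℝ :=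
  (cfc Real.sqrt (cfc Real.sqrt ρ * ξ * cfc Real.sqrt ρ)).trace.re

/-- The `α`-Rényi entropy `(1 - α)⁻¹ log₂ Tr ρ^α`; at `α = 1` the von Neumann entropy. -/
def renyiEntropy {I : Type*} [Fintype I] [DecidableEq I] (α : ℝ) (ρ : Matrix I I ℂ) : ℝ :=
  if α = 1 then -(ρ * cfc (Real.logb 2) ρ).trace.re
  else 1 / (1 - α) * Real.logb 2 (cfc (fun t : ℝ => t ^ α) ρ).trace.re

/-- The rank one operator `|ψ⟩⟨ψ|`. -/
def ketBra {I : Type*} (ψ : I → ℂ) : Matrix I I ℂ :=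
  Matrix.vecMulVec ψ (star ψ)

/-- The partial trace over the second system of `A ⊗ B ⊗ R`. -/
def traceB {A B R : Type*} [Fintype B] (W : Matrix (A × B × R) (A × B × R) ℂ) :
    Matrix (A × R) (A × R) ℂ :=
  Matrix.of fun i j => ∑ b, W (i.1, b, i.2) (j.1, b, j.2)

/-- The partial trace over the third system of `A ⊗ B ⊗ R`. -/
def traceR {A B R : Type*} [Fintype R] (W : Matrix (A × B × R) (A × B × R) ℂ) :
    Matrix (A × B) (A × B) ℂ :=
  Matrix.of fun i j => ∑ r, W (i.1, i.2, r) (j.1, j.2, r)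

/-- `|ψ⟩` on `A ⊗ B ⊗ R` purifies the state `ρ` on `A ⊗ R`. -/
def IsPurification {A B R : Type*} [Fintype B] (ψ : A × B × R → ℂ)
    (ρ : Matrix (A × R) (A × R) ℂ) : Prop :=
  traceB (ketBra ψ) = ρ

/-- The `α`-Rényi entanglement of purification `E_{α,p}(A:R)_ρ`: the infimum of
`S_α(AE)_σ`, where `σ = (id_A ⊗ N) (Tr_R |ψ⟩⟨ψ|)`, `ψ` on `A ⊗ B ⊗ R` purifies `ρ`, and
`N : B → E` is a channel, with `B` and `E` of arbitrary finite dimension. Two purifications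
of `ρ` differ by a partial isometry on `B`, which the channel can absorb, so every `ψ` gives
the same infimum. -/
def renyiEoP {A R : Type*} [Fintype A] [DecidableEq A] [Fintype R] (α : ℝ)
    (ρ : Matrix (A × R) (A × R) ℂ) : ℝ :=
  sInf {s : ℝ | ∃ (b e : ℕ) (ψ : A × Fin b × R → ℂ)
    (N : Matrix (Fin b) (Fin b) ℂ →ₗ[ℂ] Matrix (Fin e) (Fin e) ℂ),
    IsPurification ψ ρ ∧ IsCPTP N ∧
      s = renyiEntropy α (idTensor A N (traceR (ketBra ψ)))}

/-- `ρ^{⊗n}` for a bipartite `ρ`, as an operator on `A^n ⊗ R^n`. -/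
def tensorPow {A R : Type*} (ρ : Matrix (A × R) (A × R) ℂ) (n : ℕ) :
    Matrix ((Fin n → A) × (Fin n → R)) ((Fin n → A) × (Fin n → R)) ℂ :=
  Matrix.of fun i j => ∏ k, ρ (i.1 k, i.2 k) (j.1 k, j.2 k)

/-- The regularization `E^∞_{α,p}(A:R)_ρ = lim_n E_{α,p}(A^n:R^n)_{ρ^{⊗n}} / n`. -/
def regRenyiEoP {A R : Type*} [Fintype A] [DecidableEq A] [Fintype R] (α : ℝ)
    (ρ : Matrix (A × R) (A × R) ℂ) : ℝ :=
  limUnder atTop fun n : ℕ => renyiEoP α (tensorPow ρ n) / (n : ℝ)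

/-- The state `∑ x, p(x) ρ_x ⊗ |x⟩⟨x|` on `A ⊗ R` of an ensemble. -/
def cqState {A X : Type*} [Fintype X] [DecidableEq X] (p : X → ℝ) (ρ : X → Matrix A A ℂ) :
    Matrix (A × X) (A × X) ℂ :=
  ∑ x, (p x : ℂ) • (ρ x ⊗ₖ Matrix.single x x (1 : ℂ))

/-- The product state `ρ_{x₁} ⊗ ⋯ ⊗ ρ_{xₙ}` on `A^n`. -/
def productState {A X : Type*} (ρ : X → Matrix A A ℂ) {n : ℕ} (x : Fin n → X) :
    Matrix (Fin n → A) (Fin n → A) ℂ :=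
  Matrix.of fun i j => ∏ k, ρ (x k) (i k) (j k)

/-- A visible compression scheme for `n` copies: an encoding channel from `A^n C^n` to the
system `M`, where `C` carries the identity of the states, and a decoding channel from `M`
to `A^n`. -/
structure Scheme (A X : Type*) [Fintype A] [Fintype X] (n : ℕ) where
  dimM : ℕ
  enc : Matrix ((Fin n → A) × (Fin n → X)) ((Fin n → A) × (Fin n → X)) ℂ →ₗ[ℂ]
    Matrix (Fin dimM) (Fin dimM) ℂ
  dec : Matrix (Fin dimM) (Fin dimM) ℂ →ₗ[ℂ] Matrix (Fin n → A) (Fin n → A) ℂ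
  enc_cptp : IsCPTP enc
  dec_cptp : IsCPTP dec

/-- The compression rate `(1/n) log₂ |M|`. -/
def Scheme.rate {A X : Type*} [Fintype A] [Fintype X] {n : ℕ} (S : Scheme A X n) : ℝ :=
  1 / (n : ℝ) * Real.logb 2 (S.dimM : ℝ)

/-- The decoded state `ξ_x = D(C(ρ_x ⊗ |x⟩⟨x|))` for the sequence `x = (x₁, …, xₙ)`. -/
def Scheme.output {A X : Type*} [Fintype A] [Fintype X] [DecidableEq X] {n : ℕ}
    (S : Scheme A X n) (ρ : X → Matrix A A ℂ) (x : Fin n → X) :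
    Matrix (Fin n → A) (Fin n → A) ℂ :=
  S.dec (S.enc (productState ρ x ⊗ₖ Matrix.single x x (1 : ℂ)))

/-- The average fidelity `∑ p(x₁)⋯p(xₙ) F(ρ_x, ξ_x)` over all sequences `x = (x₁, …, xₙ)`. -/
def Scheme.avgFidelity {A X : Type*} [Fintype A] [DecidableEq A] [Fintype X] [DecidableEq X]
    {n : ℕ} (S : Scheme A X n) (p : X → ℝ) (ρ : X → Matrix A A ℂ) : ℝ :=
  ∑ x : Fin n → X, (∏ k, p (x k)) * fidelity (productState ρ x) (S.output ρ x)

end VisibleCompression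

end

/-!
The entanglement of purification of `ρ` on `A ⊗ R` is the infimum of `S_α(AE)` over all extensions
of `ρ` to `A ⊗ E ⊗ R` (`renyiEoP_eq`). In this form it is visibly subadditive under tensor products,
because extensions can be tensored and `S_α` is additive, and it is nonnegative, decreasing in `α`
and at most `log |A|`. Fekete's lemma then gives the regularization, together with the bound
`n E_α^∞ ≤ E_α(A^n : R^n)` for every `n`, and monotonicity in `α` gives the limit `α → 1⁺`.

The strong converse rests on a one-shot bound, `renyiEoP_cqState_le`. Dilate the decoder to an
isometry `V : M → A ⊗ E`. All dilated outputs live in the range of `V`, a subspace of dimension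
`|M|`. As in Uhlmann's theorem, an output of fidelity `F` with `ρ_x` can be turned into an extension
`σ_x` of `ρ_x` that still has weight at least `F²` in that subspace
(`exists_extension_of_fidelity`). The average `σ = ∑ p(x) σ_x` competes in the infimum that defines
`E_α`, and by Jensen's inequality an operator with weight `t` in a subspace of dimension `|M|` has
`S_α(σ) ≤ log |M| - α / (α - 1) * log t` (`IsDensity.renyiEntropy_le`). With `t` the square of the
average fidelity this reads
`log F ≤ -(α - 1) / (2 α) * (E_α(A^n : R^n) - log |M|)`,
so that a rate below `E_α^∞` for some `α > 1` makes the fidelity decay exponentially.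
-/

namespace VisibleCompression

/-! ### Spectral formulas for the Rényi entropy -/

section

variable {I J : Type*} [Fintype I] [Fintype J]

namespace IsDensity

variable {σ : Matrix I I ℂ}

theorem isHermitian (hσ : IsDensity σ) : σ.IsHermitian := hσ.1.isHermitian

theorem nonempty (hσ : IsDensity σ) : Nonempty I := by
  by_contra h
  rw [not_nonempty_iff] at h
  simpa using hσ.2

theorem kronecker {τ : Matrix J J ℂ} (hσ : IsDensity σ) (hτ : IsDensity τ) :
    IsDensity (σ ⊗ₖ τ) :=
  ⟨hσ.1.kronecker hτ.1, by rw [Matrix.trace_kronecker, hσ.2, hτ.2, mul_one]⟩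

end IsDensity

variable [DecidableEq I]

theorem trace_cfc_eq_sum_eigenvalues {σ : Matrix I I ℂ} (hσ : σ.IsHermitian) (f : ℝ → ℝ) :
    (cfc f σ).trace.re = ∑ i, f (hσ.eigenvalues i) := by
  rw [hσ.cfc_eq, Matrix.IsHermitian.cfc, Unitary.conjStarAlgAut_apply, Matrix.trace_mul_comm,
    ← mul_assoc]
  simp [Matrix.trace_diagonal]

theorem trace_cfc_eq_sum_of_charpoly {σ : Matrix I I ℂ} (hσ : σ.IsHermitian) (d : J → ℝ)
    (h : σ.charpoly = ∏ j, (Polynomial.X - Polynomial.C (d j : ℂ))) (f : ℝ → ℝ) :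
    (cfc f σ).trace.re = ∑ j, f (d j) := by
  have h1 := hσ.roots_charpoly_eq_eigenvalues
  have h2 : σ.charpoly.roots = Multiset.map (fun j => (d j : ℂ)) Finset.univ.val := by
    rw [h, ← Polynomial.roots_multiset_prod_X_sub_C (Multiset.map _ _), Multiset.map_map]
    rfl
  have h3 := congrArg (fun s : Multiset ℂ => (s.map fun z => f z.re).sum) (h1.symm.trans h2)
  simp only [Multiset.map_map, Function.comp_def] at h3
  rw [trace_cfc_eq_sum_eigenvalues hσ]
  simpa using h3

variable [DecidableEq J]

theorem trace_cfc_submatrix_equiv {σ : Matrix I I ℂ} (hσ : σ.IsHermitian) (e : J ≃ I)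
    (f : ℝ → ℝ) : (cfc f (σ.submatrix e e)).trace.re = (cfc f σ).trace.re := by
  rw [trace_cfc_eq_sum_eigenvalues hσ]
  refine trace_cfc_eq_sum_of_charpoly (hσ.submatrix e) _ ?_ f
  exact (Matrix.charpoly_reindex e.symm σ).trans hσ.charpoly_eq

theorem charpoly_kronecker {σ : Matrix I I ℂ} {τ : Matrix J J ℂ} (hσ : σ.IsHermitian)
    (hτ : τ.IsHermitian) :
    (σ ⊗ₖ τ).charpoly = ∏ k : I × J,
      (Polynomial.X - Polynomial.C ((hσ.eigenvalues k.1 * hτ.eigenvalues k.2 : ℝ) : ℂ)) := by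
  have h1 := hσ.spectral_theorem
  have h2 := hτ.spectral_theorem
  rw [Unitary.conjStarAlgAut_apply] at h1 h2
  conv_lhs => rw [h1, h2]
  rw [Matrix.mul_kronecker_mul, Matrix.mul_kronecker_mul, Matrix.charpoly_mul_comm, ← mul_assoc,
    ← Matrix.mul_kronecker_mul]
  simp [Matrix.diagonal_kronecker_diagonal, Matrix.charpoly_diagonal]

theorem renyiEntropy_submatrix_equiv {α : ℝ} (hα : α ≠ 1) {σ : Matrix I I ℂ}
    (hσ : σ.IsHermitian) (e : J ≃ I) :
    renyiEntropy α (σ.submatrix e e) = renyiEntropy α σ := by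
  rw [renyiEntropy, renyiEntropy, if_neg hα, if_neg hα, trace_cfc_submatrix_equiv hσ]

namespace IsDensity

variable {σ : Matrix I I ℂ}

theorem eigenvalues_nonneg (hσ : IsDensity σ) (i : I) : 0 ≤ hσ.isHermitian.eigenvalues i :=
  hσ.1.eigenvalues_nonneg i

theorem sum_eigenvalues (hσ : IsDensity σ) : ∑ i, hσ.isHermitian.eigenvalues i = 1 := by
  have h := hσ.isHermitian.trace_eq_sum_eigenvalues
  rw [hσ.2] at h
  simpa using (congrArg Complex.re h).symm

theorem eigenvalues_le_one (hσ : IsDensity σ) (i : I) : hσ.isHermitian.eigenvalues i ≤ 1 :=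
  hσ.sum_eigenvalues ▸ Finset.single_le_sum (fun j _ => hσ.eigenvalues_nonneg j)
    (Finset.mem_univ i)

theorem trace_rpow_pos (hσ : IsDensity σ) (α : ℝ) :
    0 < (cfc (fun t : ℝ => t ^ α) σ).trace.re := by
  rw [trace_cfc_eq_sum_eigenvalues hσ.isHermitian]
  obtain ⟨i, -, hi⟩ : ∃ i ∈ Finset.univ, 0 < hσ.isHermitian.eigenvalues i := by
    refine Finset.exists_lt_of_sum_lt (f := fun _ : I => (0 : ℝ)) ?_
    simp [hσ.sum_eigenvalues]
  exact Finset.sum_pos' (fun j _ => Real.rpow_nonneg (hσ.eigenvalues_nonneg j) _)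
    ⟨i, Finset.mem_univ i, Real.rpow_pos_of_pos hi _⟩

theorem trace_rpow_le_one (hσ : IsDensity σ) {α : ℝ} (hα : 1 ≤ α) :
    (cfc (fun t : ℝ => t ^ α) σ).trace.re ≤ 1 := by
  rw [trace_cfc_eq_sum_eigenvalues hσ.isHermitian, ← hσ.sum_eigenvalues]
  refine Finset.sum_le_sum fun i _ => ?_
  simpa using Real.rpow_le_rpow_of_exponent_ge_of_imp (hσ.eigenvalues_nonneg i)
    (hσ.eigenvalues_le_one i) hα (fun _ h => by linarith)

theorem renyiEntropy_nonneg (hσ : IsDensity σ) {α : ℝ} (hα : 1 < α) : 0 ≤ renyiEntropy α σ := by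
  rw [renyiEntropy, if_neg hα.ne']
  refine mul_nonneg_of_nonpos_of_nonpos ?_ ?_
  · exact div_nonpos_of_nonneg_of_nonpos zero_le_one (by linarith)
  · exact Real.logb_nonpos one_lt_two (hσ.trace_rpow_pos α).le (hσ.trace_rpow_le_one hα.le)

theorem renyiEntropy_kronecker {τ : Matrix J J ℂ} (hσ : IsDensity σ) (hτ : IsDensity τ) {α : ℝ}
    (hα : α ≠ 1) : renyiEntropy α (σ ⊗ₖ τ) = renyiEntropy α σ + renyiEntropy α τ := by
  rw [renyiEntropy, renyiEntropy, renyiEntropy, if_neg hα, if_neg hα, if_neg hα, ← mul_add,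
    ← Real.logb_mul (hσ.trace_rpow_pos α).ne' (hτ.trace_rpow_pos α).ne',
    trace_cfc_eq_sum_of_charpoly (hσ.kronecker hτ).isHermitian _
      (charpoly_kronecker hσ.isHermitian hτ.isHermitian),
    trace_cfc_eq_sum_eigenvalues hσ.isHermitian, trace_cfc_eq_sum_eigenvalues hτ.isHermitian,
    Finset.sum_mul_sum, Fintype.sum_prod_type]
  simp only [Real.mul_rpow (hσ.eigenvalues_nonneg _) (hτ.eigenvalues_nonneg _)]

/-- The Rényi entropy decreases in its order: this is the power mean inequality for the
exponents `α - 1 ≤ β - 1`, with the eigenvalues of `σ` as weights. -/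
theorem renyiEntropy_antitone (hσ : IsDensity σ) {α β : ℝ} (hα : 1 < α) (hαβ : α ≤ β) :
    renyiEntropy β σ ≤ renyiEntropy α σ := by
  have hβ : 1 < β := hα.trans_le hαβ
  have hα' : 0 < α - 1 := sub_pos.2 hα
  have hβ' : 0 < β - 1 := sub_pos.2 hβ
  have key : ∀ γ : ℝ, 1 < γ → (cfc (fun t : ℝ => t ^ γ) σ).trace.re
      = ∑ i, hσ.isHermitian.eigenvalues i * hσ.isHermitian.eigenvalues i ^ (γ - 1) := by
    intro γ hγ
    rw [trace_cfc_eq_sum_eigenvalues hσ.isHermitian]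
    refine Finset.sum_congr rfl fun i _ => ?_
    rw [← Real.rpow_one_add' (hσ.eigenvalues_nonneg i) (by linarith)]
    congr 1
    ring
  have h := Real.rpow_arith_mean_le_arith_mean_rpow Finset.univ hσ.isHermitian.eigenvalues
    (fun i => hσ.isHermitian.eigenvalues i ^ (α - 1)) (fun i _ => hσ.eigenvalues_nonneg i)
    hσ.sum_eigenvalues (fun i _ => Real.rpow_nonneg (hσ.eigenvalues_nonneg i) _)
    (p := (β - 1) / (α - 1)) ((one_le_div hα').2 (by linarith))
  simp only [← Real.rpow_mul (hσ.eigenvalues_nonneg _), mul_div_cancel₀ _ hα'.ne'] at h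
  rw [← key α hα, ← key β hβ] at h
  have hl := Real.logb_le_logb_of_le one_lt_two
    (Real.rpow_pos_of_pos (hσ.trace_rpow_pos α) _) h
  rw [Real.logb_rpow_eq_mul_logb_of_pos (hσ.trace_rpow_pos α)] at hl
  rw [renyiEntropy, renyiEntropy, if_neg hα.ne', if_neg hβ.ne']
  have e : ∀ γ x : ℝ, 1 / (1 - γ) * x = -(x / (γ - 1)) := fun γ x => by
    rw [one_div_mul_eq_div, ← neg_sub γ 1, div_neg]
  rw [e, e, neg_le_neg_iff, le_div_iff₀ hβ']
  calc _ = _ := by ring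
    _ ≤ _ := hl

/-- A density operator that gives weight `Re tr(Pσ)` to a subspace of dimension `m` has Rényi
entropy at most about `log m`. The proof is Jensen's inequality for the power `α`, the
eigenvalues of `σ` being weighted by the diagonal of `P` in the eigenbasis. -/
theorem renyiEntropy_le (hσ : IsDensity σ) {α : ℝ} (hα : 1 < α) {P : Matrix I I ℂ}
    (hP : P.PosSemidef) (hP1 : (1 - P).PosSemidef) {m : ℝ} (hm : 0 < m) (hPm : P.trace = m)
    {t : ℝ} (ht : 0 < t) (htP : t ≤ (P * σ).trace.re) :
    renyiEntropy α σ ≤ Real.logb 2 m - α / (α - 1) * Real.logb 2 t := by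
  set U : Matrix I I ℂ := (hσ.isHermitian.eigenvectorUnitary : Matrix I I ℂ) with hU
  have hUU : star U * U = 1 := Unitary.coe_star_mul_self _
  have hUU' : U * star U = 1 := Unitary.coe_mul_star_self _
  set Q : Matrix I I ℂ := star U * P * U with hQ
  have hQpos : Q.PosSemidef := hP.conjTranspose_mul_mul_same U
  have hQ1 : (1 - Q).PosSemidef := by
    have := hP1.conjTranspose_mul_mul_same U
    rwa [Matrix.mul_sub, Matrix.sub_mul, Matrix.mul_one, ← Matrix.star_eq_conjTranspose,
      hUU] at this
  set w : I → ℝ := fun i => (Q i i).re with hw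
  have hw0 : ∀ i, 0 ≤ w i := fun i => (Complex.le_def.1 (hQpos.diag_nonneg (i := i))).1
  have hw1 : ∀ i, w i ≤ 1 := fun i => by
    have := (Complex.le_def.1 (hQ1.diag_nonneg (i := i))).1
    simpa using this
  have hwm : ∑ i, w i = m := by
    have : Q.trace = m := by
      rw [hQ, Matrix.trace_mul_comm, ← mul_assoc, hUU', one_mul, hPm]
    simpa [Matrix.trace, hw] using congrArg Complex.re this
  have hws : (P * σ).trace.re = ∑ i, w i * hσ.isHermitian.eigenvalues i := by
    have h1 := hσ.isHermitian.spectral_theorem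
    rw [Unitary.conjStarAlgAut_apply] at h1
    conv_lhs => rw [h1]
    rw [← mul_assoc, Matrix.trace_mul_comm, ← mul_assoc, ← mul_assoc, ← hU]
    change (Q * _).trace.re = _
    simp [Matrix.trace, Matrix.mul_diagonal, hw]
  have hJ := Real.rpow_arith_mean_le_arith_mean_rpow Finset.univ (fun i => w i / m)
    hσ.isHermitian.eigenvalues (fun i _ => div_nonneg (hw0 i) hm.le)
    (by rw [← Finset.sum_div, hwm, div_self hm.ne']) (fun i _ => hσ.eigenvalues_nonneg i) hα.le
  have h2 : (t / m) ^ α ≤ (cfc (fun t : ℝ => t ^ α) σ).trace.re / m := by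
    calc (t / m) ^ α ≤ (∑ i, w i / m * hσ.isHermitian.eigenvalues i) ^ α := by
          refine Real.rpow_le_rpow (by positivity) ?_ (by linarith)
          simp only [div_mul_eq_mul_div]
          rw [← Finset.sum_div, ← hws]
          gcongr
      _ ≤ _ := hJ
      _ ≤ _ := by
          rw [trace_cfc_eq_sum_eigenvalues hσ.isHermitian, Finset.sum_div]
          refine Finset.sum_le_sum fun i _ => ?_
          rw [div_mul_eq_mul_div]
          have := Real.rpow_nonneg (hσ.eigenvalues_nonneg i) α
          gcongr
          exact mul_le_of_le_one_left this (hw1 i)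
  have hl := Real.logb_le_logb_of_le one_lt_two (by positivity) h2
  rw [Real.logb_rpow_eq_mul_logb_of_pos (by positivity), Real.logb_div ht.ne' hm.ne',
    Real.logb_div (hσ.trace_rpow_pos α).ne' hm.ne'] at hl
  rw [renyiEntropy, if_neg hα.ne']
  have hα' : 0 < α - 1 := sub_pos.2 hα
  have e : ∀ x : ℝ, 1 / (1 - α) * x = -(x / (α - 1)) := fun x => by
    rw [one_div_mul_eq_div, ← neg_sub α 1, div_neg]
  rw [e, neg_le, le_div_iff₀ hα']
  have e2 : α / (α - 1) * Real.logb 2 t * (α - 1) = α * Real.logb 2 t := by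
    field_simp
  nlinarith [e2]

theorem renyiEntropy_le_logb_card (hσ : IsDensity σ) {α : ℝ} (hα : 1 < α) :
    renyiEntropy α σ ≤ Real.logb 2 (Fintype.card I) := by
  have hI := hσ.nonempty
  have := hσ.renyiEntropy_le hα (P := 1) (m := Fintype.card I) (t := 1) Matrix.PosSemidef.one
    (by simpa using Matrix.PosSemidef.zero) (by exact_mod_cast Fintype.card_pos)
    (by simp) one_pos (by simp [hσ.2])
  simpa using this

end IsDensity

end

/-! ### Entanglement of purification through extensions -/

/-- A positive matrix factors through its square root. -/
theorem exists_eq_mul_conjTranspose {I : Type*} [Fintype I] {W : Matrix I I ℂ}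
    (hW : W.PosSemidef) : ∃ Y : Matrix I I ℂ, W = Y * Y.conjTranspose := by
  classical
  open scoped MatrixOrder in
  obtain ⟨Z, hZ⟩ := CStarAlgebra.nonneg_iff_eq_star_mul_self.1 hW.nonneg
  exact ⟨Z.conjTranspose, by simpa [Matrix.star_eq_conjTranspose] using hZ⟩

section

variable {A B E R : Type*}

/-- The operator `Ω` on `A ⊗ E ⊗ R` is positive and restricts to `ρ` on `A ⊗ R`. -/
def IsExtension [Fintype E] (Ω : Matrix (A × E × R) (A × E × R) ℂ)
    (ρ : Matrix (A × R) (A × R) ℂ) : Prop :=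
  Ω.PosSemidef ∧ traceB Ω = ρ

theorem posSemidef_traceR [Fintype R] {Ω : Matrix (A × E × R) (A × E × R) ℂ}
    (hΩ : Ω.PosSemidef) : (traceR Ω).PosSemidef := by
  have : traceR Ω = ∑ r, Ω.submatrix (fun i : A × E => (i.1, i.2, r)) (fun i => (i.1, i.2, r)) := by
    ext i j
    simp [traceR, Matrix.sum_apply]
  rw [this]
  exact Matrix.posSemidef_sum _ fun r _ => hΩ.submatrix _

theorem trace_traceR [Fintype A] [Fintype E] [Fintype R] (Ω : Matrix (A × E × R) (A × E × R) ℂ) :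
    (traceR Ω).trace = (traceB Ω).trace := by
  simp only [Matrix.trace, Matrix.diag, traceR, traceB, Matrix.of_apply, Fintype.sum_prod_type]
  exact Finset.sum_congr rfl fun a _ => Finset.sum_comm

theorem IsExtension.isDensity_traceR [Fintype A] [Fintype E] [Fintype R]
    {Ω : Matrix (A × E × R) (A × E × R) ℂ} {ρ : Matrix (A × R) (A × R) ℂ}
    (hΩ : IsExtension Ω ρ) (hρ : IsDensity ρ) : IsDensity (traceR Ω) :=
  ⟨posSemidef_traceR hΩ.1, by rw [trace_traceR, hΩ.2, hρ.2]⟩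

/-- Complete positivity for an arbitrary finite ancilla in place of `Fin k`. -/
theorem IsCPTP.posSemidef_idTensor {K : Type*} [Fintype K] [Fintype B] [Fintype E]
    {N : Matrix B B ℂ →ₗ[ℂ] Matrix E E ℂ} (hN : IsCPTP N) {W : Matrix (K × B) (K × B) ℂ}
    (hW : W.PosSemidef) : (idTensor K N W).PosSemidef := by
  let f := Fintype.equivFin K
  have h := hN.completelyPositive _ _ (hW.submatrix (fun i : Fin _ × B => (f.symm i.1, i.2)))
  have h2 := h.submatrix (fun i : K × E => (f i.1, i.2))
  convert! h2 using 1
  ext i j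
  simp [idTensor]

theorem IsCPTP.posSemidef [Fintype B] [Fintype E]
    {N : Matrix B B ℂ →ₗ[ℂ] Matrix E E ℂ} (hN : IsCPTP N) {W : Matrix B B ℂ}
    (hW : W.PosSemidef) : (N W).PosSemidef := by
  have h := hN.posSemidef_idTensor (K := Unit) (hW.submatrix Prod.snd)
  have h2 := h.submatrix (fun i : E => ((), i))
  convert! h2 using 1

/-- The partial trace over the second factor of `B ≃ E × G`, as a linear map. -/
def partialTrace {G : Type*} [Fintype G] (f : B ≃ E × G) :
    Matrix B B ℂ →ₗ[ℂ] Matrix E E ℂ where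
  toFun W := ∑ g, W.submatrix (fun e => f.symm (e, g)) (fun e => f.symm (e, g))
  map_add' W W' := by
    ext
    simp [Matrix.sum_apply, Finset.sum_add_distrib]
  map_smul' c W := by
    ext
    simp [Matrix.sum_apply, Finset.mul_sum]

theorem partialTrace_apply {G : Type*} [Fintype G] (f : B ≃ E × G) (W : Matrix B B ℂ) (i j : E) :
    partialTrace f W i j = ∑ g, W (f.symm (i, g)) (f.symm (j, g)) := by
  simp [partialTrace, Matrix.sum_apply]

theorem isCPTP_partialTrace {G : Type*} [Fintype B] [Fintype E] [Fintype G] (f : B ≃ E × G) :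
    IsCPTP (partialTrace f) where
  completelyPositive k W hW := by
    have : idTensor (Fin k) (partialTrace f) W = ∑ g, W.submatrix
        (fun i : Fin k × E => (i.1, f.symm (i.2, g))) (fun i => (i.1, f.symm (i.2, g))) := by
      ext i j
      simp [idTensor, partialTrace_apply, Matrix.sum_apply]
    rw [this]
    exact Matrix.posSemidef_sum _ fun g _ => hW.submatrix _
  tracePreserving W := by
    simp only [Matrix.trace, Matrix.diag, partialTrace_apply]
    rw [← Fintype.sum_prod_type' (fun e g => W (f.symm (e, g)) (f.symm (e, g)))]
    exact Equiv.sum_comp f.symm fun b => W b b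

/-- Neither purifications nor channels are needed to describe the entanglement of purification:
it is the infimum of `S_α(AE)` over the extensions of `ρ` to `A ⊗ E ⊗ R`. A channel on the
purifying system produces an extension; conversely an extension has a purification on
`A ⊗ (E ⊗ G) ⊗ R`, and the channel is then the partial trace over `G`. -/
theorem renyiEoP_eq [Fintype A] [DecidableEq A] [Fintype R] (α : ℝ)
    (ρ : Matrix (A × R) (A × R) ℂ) :
    renyiEoP α ρ = sInf {s : ℝ | ∃ (e : ℕ) (Ω : Matrix (A × Fin e × R) (A × Fin e × R) ℂ),
      IsExtension Ω ρ ∧ s = renyiEntropy α (traceR Ω)} := by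
  classical
  unfold renyiEoP
  congr 1
  ext s
  constructor
  · rintro ⟨b, e, ψ, N, hψ, hN, rfl⟩
    let W : Matrix ((A × R) × Fin b) ((A × R) × Fin b) ℂ :=
      (ketBra ψ).submatrix (fun i => (i.1.1, i.2, i.1.2)) (fun i => (i.1.1, i.2, i.1.2))
    have hW : W.PosSemidef := (Matrix.posSemidef_vecMulVec_self_star ψ).submatrix _
    refine ⟨e, (idTensor (A × R) N W).submatrix (fun i => ((i.1, i.2.2), i.2.1))
      (fun i => ((i.1, i.2.2), i.2.1)), ⟨(hN.posSemidef_idTensor hW).submatrix _, ?_⟩, ?_⟩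
    · rw [← hψ]
      ext i j
      exact hN.tracePreserving (Matrix.of fun b b' => ketBra ψ (i.1, b, i.2) (j.1, b', j.2))
    · congr 1
      ext i j
      have : (Matrix.of fun x y => traceR (ketBra ψ) (i.1, x) (j.1, y)) =
          ∑ r, Matrix.of fun x y => W ((i.1, r), x) ((j.1, r), y) := by
        ext x y
        simp [traceR, Matrix.sum_apply, W]
      simp only [idTensor, Matrix.of_apply, this, map_sum, Matrix.sum_apply]
      simp [traceR]
  · rintro ⟨e, Ω, ⟨hΩ, hρ⟩, rfl⟩
    obtain ⟨Y, hY⟩ := exists_eq_mul_conjTranspose hΩ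
    let G := A × Fin e × R
    let f : Fin (Fintype.card (Fin e × G)) ≃ Fin e × G := (Fintype.equivFin _).symm
    refine ⟨_, e, fun i => Y (i.1, (f i.2.1).1, i.2.2) (f i.2.1).2, partialTrace f, ?_,
      isCPTP_partialTrace f, ?_⟩
    · rw [IsPurification, ← hρ, hY]
      ext i j
      simp only [traceB, ketBra, Matrix.of_apply, Matrix.vecMulVec_apply, Matrix.mul_apply,
        Pi.star_apply, Matrix.conjTranspose_apply]
      rw [← Fintype.sum_prod_type' (fun (x : Fin e) (g : G) =>
        Y (i.1, x, i.2) g * star (Y (j.1, x, j.2) g))]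
      exact Equiv.sum_comp f fun z : Fin e × G =>
        Y (i.1, z.1, i.2) z.2 * star (Y (j.1, z.1, j.2) z.2)
    · congr 1
      ext i j
      simp only [hY, traceR, ketBra, Matrix.of_apply, Matrix.vecMulVec_apply, Matrix.mul_apply,
        Pi.star_apply, Matrix.conjTranspose_apply, idTensor, partialTrace_apply,
        Equiv.apply_symm_apply]
      exact Finset.sum_comm

end

section

variable {A E R : Type*} [Fintype A] [DecidableEq A] [Fintype R]

theorem IsExtension.renyiEoP_le [Fintype E] [DecidableEq E]
    {Ω : Matrix (A × E × R) (A × E × R) ℂ} {ρ : Matrix (A × R) (A × R) ℂ}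
    (hΩ : IsExtension Ω ρ) (hρ : IsDensity ρ) {α : ℝ} (hα : 1 < α) :
    renyiEoP α ρ ≤ renyiEntropy α (traceR Ω) := by
  rw [renyiEoP_eq]
  refine csInf_le ⟨0, ?_⟩ ?_
  · rintro _ ⟨e, Ω', hΩ', rfl⟩
    exact (hΩ'.isDensity_traceR hρ).renyiEntropy_nonneg hα
  · let f : Fin (Fintype.card E) ≃ E := (Fintype.equivFin E).symm
    refine ⟨_, Ω.submatrix (fun i => (i.1, f i.2.1, i.2.2)) (fun i => (i.1, f i.2.1, i.2.2)),
      ⟨hΩ.1.submatrix _, ?_⟩, ?_⟩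
    · rw [← hΩ.2]
      ext i j
      exact Equiv.sum_comp f fun x => Ω (i.1, x, i.2) (j.1, x, j.2)
    · rw [← renyiEntropy_submatrix_equiv hα.ne' (posSemidef_traceR hΩ.1).isHermitian
        ((Equiv.refl A).prodCongr f)]
      rfl

variable {ρ : Matrix (A × R) (A × R) ℂ}

theorem le_renyiEoP (hρ : IsDensity ρ) {α c : ℝ}
    (h : ∀ (e : ℕ) (Ω : Matrix (A × Fin e × R) (A × Fin e × R) ℂ), IsExtension Ω ρ →
      c ≤ renyiEntropy α (traceR Ω)) : c ≤ renyiEoP α ρ := by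
  rw [renyiEoP_eq]
  refine le_csInf ?_ ?_
  · exact ⟨_, 1, ρ.submatrix (fun i => (i.1, i.2.2)) (fun i => (i.1, i.2.2)),
      ⟨hρ.1.submatrix _, by ext i j; simp [traceB]⟩, rfl⟩
  · rintro _ ⟨e, Ω, hΩ, rfl⟩
    exact h e Ω hΩ

theorem renyiEoP_nonneg (hρ : IsDensity ρ) {α : ℝ} (hα : 1 < α) : 0 ≤ renyiEoP α ρ :=
  le_renyiEoP hρ fun _ _ hΩ => (hΩ.isDensity_traceR hρ).renyiEntropy_nonneg hα

theorem renyiEoP_le_logb_card (hρ : IsDensity ρ) {α : ℝ} (hα : 1 < α) :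
    renyiEoP α ρ ≤ Real.logb 2 (Fintype.card A) := by
  have h : IsExtension
      (ρ.submatrix (fun i : A × Unit × R => (i.1, i.2.2)) (fun i => (i.1, i.2.2))) ρ :=
    ⟨hρ.1.submatrix _, by ext i j; simp [traceB]⟩
  refine (h.renyiEoP_le hρ hα).trans ?_
  simpa using (h.isDensity_traceR hρ).renyiEntropy_le_logb_card hα

theorem renyiEoP_antitone (hρ : IsDensity ρ) {α β : ℝ} (hα : 1 < α) (hαβ : α ≤ β) :
    renyiEoP β ρ ≤ renyiEoP α ρ :=
  le_renyiEoP hρ fun _ _ hΩ => (hΩ.renyiEoP_le hρ (hα.trans_le hαβ)).trans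
    ((hΩ.isDensity_traceR hρ).renyiEntropy_antitone hα hαβ)

end

/-! ### Tensor powers and regularization -/

section

variable {A R : Type*}

/-- Schur product theorem for finitely many factors, each a pulled back positive matrix. -/
theorem posSemidef_prod_submatrix {ι I J : Type*} [Finite J] (s : Finset ι)
    {M : ι → Matrix I I ℂ} (hM : ∀ k, (M k).PosSemidef) (f : ι → J → I) :
    (Matrix.of fun i j : J => ∏ k ∈ s, M k (f k i) (f k j)).PosSemidef := by
  classical
  have := Fintype.ofFinite J
  induction s using Finset.induction_on with
  | empty =>
    convert! Matrix.posSemidef_vecMulVec_self_star (fun _ : J => (1 : ℂ)) using 1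
    ext i j
    simp [Matrix.vecMulVec_apply]
  | insert k s hk ih =>
    convert! ((hM k).submatrix (f k)).hadamard ih using 1
    ext i j
    simp [Finset.prod_insert hk, Matrix.hadamard_apply]

theorem IsDensity.tensorPow [Fintype A] [Fintype R] {ρ : Matrix (A × R) (A × R) ℂ}
    (hρ : IsDensity ρ) (n : ℕ) : IsDensity (tensorPow ρ n) := by
  classical
  refine ⟨posSemidef_prod_submatrix Finset.univ (fun _ => hρ.1)
    (fun k (i : (Fin n → A) × (Fin n → R)) => (i.1 k, i.2 k)), ?_⟩
  have h : ∑ z : Fin n → A × R, ∏ k, ρ (z k) (z k) = 1 := by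
    rw [← Fintype.prod_sum (fun (_ : Fin n) z => ρ z z)]
    exact Finset.prod_eq_one fun _ _ => hρ.2
  rw [← h, Matrix.trace]
  exact (Equiv.sum_comp (Equiv.arrowProdEquivProdArrow (Fin n) (fun _ => A) (fun _ => R))
    fun i => VisibleCompression.tensorPow ρ n i i).symm

theorem IsDensity.productState [Fintype A] {X : Type*} {ρ : X → Matrix A A ℂ}
    (hρ : ∀ x, IsDensity (ρ x)) {n : ℕ} (x : Fin n → X) : IsDensity (productState ρ x) := by
  classical
  refine ⟨posSemidef_prod_submatrix Finset.univ (fun k => (hρ (x k)).1)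
    (fun k (i : Fin n → A) => i k), ?_⟩
  have h := Fintype.prod_sum (fun (k : Fin n) (a : A) => ρ (x k) a a)
  exact h.symm.trans (Finset.prod_eq_one fun k _ => (hρ (x k)).2)

variable [Fintype A] [DecidableEq A] [Fintype R] {ρ : Matrix (A × R) (A × R) ℂ}

theorem subadditive_renyiEoP (hρ : IsDensity ρ) {α : ℝ} (hα : 1 < α) :
    Subadditive fun n => renyiEoP α (tensorPow ρ n) := by
  intro m n
  beta_reduce
  rw [← sub_le_iff_le_add']
  refine le_renyiEoP (hρ.tensorPow n) fun e₂ Ω₂ h₂ => ?_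
  rw [sub_le_comm]
  refine le_renyiEoP (hρ.tensorPow m) fun e₁ Ω₁ h₁ => ?_
  rw [sub_le_iff_le_add]
  -- `g` splits the `m + n` copies of all three systems, `f` those of `A ⊗ E` alone.
  let g : (Fin (m + n) → A) × (Fin e₁ × Fin e₂) × (Fin (m + n) → R) →
      ((Fin m → A) × Fin e₁ × (Fin m → R)) × ((Fin n → A) × Fin e₂ × (Fin n → R)) := fun i =>
    ((fun k => i.1 (Fin.castAdd n k), i.2.1.1, fun k => i.2.2 (Fin.castAdd n k)),
      (fun k => i.1 (Fin.natAdd m k), i.2.1.2, fun k => i.2.2 (Fin.natAdd m k)))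
  let f : (Fin (m + n) → A) × (Fin e₁ × Fin e₂) ≃
      ((Fin m → A) × Fin e₁) × ((Fin n → A) × Fin e₂) :=
    ((Fin.appendEquiv m n).symm.prodCongr (Equiv.refl _)).trans (Equiv.prodProdProdComm _ _ _ _)
  have hΩ : IsExtension ((Ω₁ ⊗ₖ Ω₂).submatrix g g) (tensorPow ρ (m + n)) := by
    refine ⟨(h₁.1.kronecker h₂.1).submatrix g, ?_⟩
    ext i j
    have e₁ := congrFun₂ h₁.2 (fun k => i.1 (Fin.castAdd n k), fun k => i.2 (Fin.castAdd n k))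
      (fun k => j.1 (Fin.castAdd n k), fun k => j.2 (Fin.castAdd n k))
    have e₂ := congrFun₂ h₂.2 (fun k => i.1 (Fin.natAdd m k), fun k => i.2 (Fin.natAdd m k))
      (fun k => j.1 (Fin.natAdd m k), fun k => j.2 (Fin.natAdd m k))
    simp only [traceB, tensorPow, Matrix.of_apply] at e₁ e₂ ⊢
    rw [Fin.prod_univ_add, ← e₁, ← e₂, Finset.sum_mul_sum, Fintype.sum_prod_type]
    rfl
  have htr : traceR ((Ω₁ ⊗ₖ Ω₂).submatrix g g) =
      (traceR Ω₁ ⊗ₖ traceR Ω₂).submatrix f f := by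
    ext i j
    simp only [traceR, Matrix.of_apply, Matrix.submatrix_apply, Matrix.kroneckerMap_apply]
    rw [Finset.sum_mul_sum, ← Fintype.sum_prod_type',
      ← Equiv.sum_comp (Fin.appendEquiv m n).symm]
    rfl
  have d₁ := h₁.isDensity_traceR (hρ.tensorPow m)
  have d₂ := h₂.isDensity_traceR (hρ.tensorPow n)
  have := hΩ.renyiEoP_le (hρ.tensorPow (m + n)) hα
  rwa [htr, renyiEntropy_submatrix_equiv hα.ne' (d₁.kronecker d₂).isHermitian,
    d₁.renyiEntropy_kronecker d₂ hα.ne'] at this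

theorem bddBelow_renyiEoP_div (hρ : IsDensity ρ) {α : ℝ} (hα : 1 < α) :
    BddBelow (Set.range fun n : ℕ => renyiEoP α (tensorPow ρ n) / (n : ℝ)) := by
  refine ⟨0, ?_⟩
  rintro _ ⟨n, rfl⟩
  exact div_nonneg (renyiEoP_nonneg (hρ.tensorPow n) hα) n.cast_nonneg

theorem tendsto_regRenyiEoP (hρ : IsDensity ρ) {α : ℝ} (hα : 1 < α) :
    Tendsto (fun n : ℕ => renyiEoP α (tensorPow ρ n) / (n : ℝ)) atTop
      (𝓝 (regRenyiEoP α ρ)) :=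
  tendsto_nhds_limUnder
    ⟨_, (subadditive_renyiEoP hρ hα).tendsto_lim (bddBelow_renyiEoP_div hρ hα)⟩

/-- By Fekete's lemma the regularization is a lower bound for every `n`, not only a limit. -/
theorem regRenyiEoP_le_div (hρ : IsDensity ρ) {α : ℝ} (hα : 1 < α) {n : ℕ} (hn : n ≠ 0) :
    regRenyiEoP α ρ ≤ renyiEoP α (tensorPow ρ n) / (n : ℝ) := by
  have hb := bddBelow_renyiEoP_div hρ hα
  have hs := subadditive_renyiEoP hρ hα
  rw [tendsto_nhds_unique (tendsto_regRenyiEoP hρ hα) (hs.tendsto_lim hb)]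
  exact hs.lim_le_div hb hn

theorem regRenyiEoP_antitone (hρ : IsDensity ρ) {α β : ℝ} (hα : 1 < α) (hαβ : α ≤ β) :
    regRenyiEoP β ρ ≤ regRenyiEoP α ρ :=
  le_of_tendsto_of_tendsto' (tendsto_regRenyiEoP hρ (hα.trans_le hαβ))
    (tendsto_regRenyiEoP hρ hα) fun n =>
      div_le_div_of_nonneg_right (renyiEoP_antitone (hρ.tensorPow n) hα hαβ) n.cast_nonneg

theorem regRenyiEoP_le_logb_card (hρ : IsDensity ρ) {α : ℝ} (hα : 1 < α) :
    regRenyiEoP α ρ ≤ Real.logb 2 (Fintype.card A) := by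
  refine (regRenyiEoP_le_div hρ hα one_ne_zero).trans ?_
  simpa using renyiEoP_le_logb_card (hρ.tensorPow 1) hα

/-- Monotonicity and the uniform bound by `log |A|` give the limit `α → 1⁺`, a supremum. -/
theorem tendsto_regRenyiEoP_nhdsGT (hρ : IsDensity ρ) :
    Tendsto (fun α => regRenyiEoP α ρ) (𝓝[>] 1)
      (𝓝 (sSup ((fun α => regRenyiEoP α ρ) '' Set.Ioi 1))) := by
  have hanti : AntitoneOn (fun α => regRenyiEoP α ρ) (Set.Ioi 1) :=
    fun _ ha _ _ hab => regRenyiEoP_antitone hρ ha hab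
  refine MonotoneOn.tendsto_nhdsGT (β := ℝᵒᵈ) hanti ⟨Real.logb 2 (Fintype.card A), ?_⟩
  rintro _ ⟨α, hα, rfl⟩
  exact regRenyiEoP_le_logb_card hρ hα

end

/-! ### Isometric dilation of the decoder -/

/-- Stinespring dilation, read off from a square root of the Choi matrix. -/
theorem IsCPTP.exists_isometry {M A : Type*} [Fintype M] [DecidableEq M] [Fintype A]
    {N : Matrix M M ℂ →ₗ[ℂ] Matrix A A ℂ} (hN : IsCPTP N) :
    ∃ V : Matrix (A × (M × A)) M ℂ, V.conjTranspose * V = 1 ∧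
      ∀ τ, N τ = partialTrace (Equiv.refl (A × (M × A))) (V * τ * V.conjTranspose) := by
  have hW := Matrix.posSemidef_vecMulVec_self_star
    (fun i : M × M => if i.1 = i.2 then (1 : ℂ) else 0)
  obtain ⟨Y, hY⟩ := exists_eq_mul_conjTranspose (hN.posSemidef_idTensor hW)
  have hJ : ∀ m a m' a', N (Matrix.single m m' 1) a a' = ∑ e, Y (m, a) e * star (Y (m', a') e) := by
    intro m a m' a'
    have h := congrFun₂ hY (m, a) (m', a')
    rw [Matrix.mul_apply] at h
    simp only [Matrix.conjTranspose_apply] at h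
    rw [← h]
    refine congrFun₂ (congrArg N ?_) a a'
    ext b b'
    by_cases h1 : m = b <;> by_cases h2 : m' = b' <;>
      simp [Matrix.vecMulVec_apply, h1, h2]
  -- The columns of the square root `Y` are the Kraus operators.
  refine ⟨Matrix.of fun i m => Y (m, i.1) i.2, ?_, fun τ => ?_⟩
  · ext m' m
    have h := hN.tracePreserving (Matrix.single m m' 1)
    simp only [Matrix.trace, Matrix.diag, hJ] at h
    rw [Matrix.mul_apply, Fintype.sum_prod_type]
    simp only [Matrix.conjTranspose_apply, Matrix.of_apply]
    simp only [mul_comm (star _)]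
    rw [h]
    by_cases hm : m = m'
    · subst hm
      simp [Matrix.single_apply]
    · rw [Matrix.one_apply_ne (Ne.symm hm)]
      refine Finset.sum_eq_zero fun i _ => Matrix.single_apply_of_ne _ _ _ _ _ ?_
      rintro ⟨rfl, rfl⟩
      exact hm rfl
  · ext a a'
    have hτ : N τ = ∑ m, ∑ m', τ m m' • N (Matrix.single m m' 1) := by
      conv_lhs => rw [Matrix.matrix_eq_sum_single τ]
      simp only [map_sum]
      refine Finset.sum_congr rfl fun m _ => Finset.sum_congr rfl fun m' _ => ?_
      rw [← map_smul, Matrix.smul_single, smul_eq_mul, mul_one]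
    rw [hτ, partialTrace_apply]
    simp only [Matrix.sum_apply, Matrix.smul_apply, hJ, Matrix.mul_apply, smul_eq_mul,
      Finset.mul_sum, Finset.sum_mul, Matrix.conjTranspose_apply, Matrix.of_apply,
      Equiv.refl_symm, Equiv.refl_apply]
    conv_rhs => enter [2, g]; rw [Finset.sum_comm]
    conv_rhs => rw [Finset.sum_comm]; enter [2, m]; rw [Finset.sum_comm]
    refine Finset.sum_congr rfl fun m _ => Finset.sum_congr rfl fun m' _ =>
      Finset.sum_congr rfl fun e _ => ?_
    ring

/-! ### Fidelity -/

section

variable {I : Type*} [Fintype I] [DecidableEq I]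

theorem continuousOn_spectrum (H : Matrix I I ℂ) (f : ℝ → ℝ) :
    ContinuousOn f (spectrum ℝ H) := by
  have : (spectrum ℝ H).Finite := Matrix.finite_real_spectrum
  exact this.continuousOn f

theorem posSemidef_cfc {f : ℝ → ℝ} (hf : ∀ t, 0 ≤ f t) (H : Matrix I I ℂ) :
    (cfc f H).PosSemidef := by
  open scoped MatrixOrder in
  exact Matrix.nonneg_iff_posSemidef.1 (cfc_nonneg fun t _ => hf t)

theorem cfc_sqrt_mul_self {ρ : Matrix I I ℂ} (hρ : ρ.PosSemidef) :
    cfc Real.sqrt ρ * cfc Real.sqrt ρ = ρ := by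
  have hs : IsSelfAdjoint ρ := hρ.isHermitian
  rw [← cfc_mul _ _ ρ (continuousOn_spectrum ρ _) (continuousOn_spectrum ρ _)]
  conv_rhs => rw [← cfc_id ℝ ρ]
  refine cfc_congr fun t ht => ?_
  rw [hρ.isHermitian.spectrum_real_eq_range_eigenvalues] at ht
  obtain ⟨i, rfl⟩ := ht
  exact Real.mul_self_sqrt (hρ.eigenvalues_nonneg i)

theorem fidelity_nonneg (ρ ξ : Matrix I I ℂ) : 0 ≤ fidelity ρ ξ :=
  (Complex.le_def.1 (posSemidef_cfc Real.sqrt_nonneg _).trace_nonneg).1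

/-- The operator that carries `ξ` towards `ρ`. With `H = √ρ ξ √ρ` it is
`√ρ H^(-1/2) √ρ`, the inverse being taken on the support of `H`; for invertible states
`B ξ B = ρ`, so that `B` plays the role of the optimal unitary in Uhlmann's theorem. -/
theorem exists_transport {ρ ξ : Matrix I I ℂ} (hρ : ρ.PosSemidef) (hξ : ξ.PosSemidef) :
    ∃ B : Matrix I I ℂ, B.IsHermitian ∧ (ρ - B * ξ * B).PosSemidef ∧
      (B * ξ).trace = fidelity ρ ξ := by
  set S := cfc Real.sqrt ρ with hS
  have hSpos : S.PosSemidef := posSemidef_cfc Real.sqrt_nonneg ρ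
  have hSS : S * S = ρ := cfc_sqrt_mul_self hρ
  set H := S * ξ * S with hH
  have hHpos : H.PosSemidef := by
    have := hξ.mul_mul_conjTranspose_same S
    rwa [hSpos.isHermitian.eq] at this
  have hHs : IsSelfAdjoint H := hHpos.isHermitian
  set G := cfc (fun t => (Real.sqrt t)⁻¹) H with hG
  have hGpos : G.PosSemidef := posSemidef_cfc (fun t => inv_nonneg.2 (Real.sqrt_nonneg t)) H
  -- Holds on the kernel of `H` too, because `(√0)⁻¹ = 0`.
  have hGH : G * H = cfc Real.sqrt H := by
    conv_lhs => enter [2]; rw [← cfc_id ℝ H]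
    rw [hG, ← cfc_mul _ _ H (continuousOn_spectrum H _) (continuousOn_spectrum H _)]
    congr 1
    ext t
    rw [id, inv_mul_eq_div, Real.div_sqrt]
  have hGHG : (1 - G * H * G).PosSemidef := by
    rw [hGH, hG, ← cfc_mul _ _ H (continuousOn_spectrum H _) (continuousOn_spectrum H _),
      ← cfc_one ℝ H, ← cfc_sub _ _ H (continuousOn_spectrum H _) (continuousOn_spectrum H _)]
    exact posSemidef_cfc (fun t => sub_nonneg.2 mul_inv_le_one) H
  refine ⟨S * G * S, ?_, ?_, ?_⟩
  · have := hGpos.mul_mul_conjTranspose_same S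
    rw [hSpos.isHermitian.eq] at this
    exact this.isHermitian
  · have := hGHG.mul_mul_conjTranspose_same S
    rw [hSpos.isHermitian.eq] at this
    convert! this using 1
    rw [Matrix.mul_sub, Matrix.sub_mul, Matrix.mul_one, hSS, hH]
    simp only [Matrix.mul_assoc]
  · have h1 : (S * G * S * ξ).trace = (G * H).trace := by
      rw [hH, Matrix.mul_assoc S G S, Matrix.mul_assoc S, Matrix.trace_mul_comm S]
      simp only [Matrix.mul_assoc]
    have h2 : star (cfc Real.sqrt H).trace = (cfc Real.sqrt H).trace := by
      rw [← Matrix.trace_conjTranspose, (posSemidef_cfc Real.sqrt_nonneg H).isHermitian.eq]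
    rw [h1, hGH, fidelity, ← hS, ← hH]
    exact (Complex.conj_eq_iff_re.1 h2).symm

end

section

variable {A E M : Type*} [Fintype A] [Fintype E] [Fintype M]

theorem trace_partialTrace (W : Matrix (A × E) (A × E) ℂ) :
    (partialTrace (Equiv.refl (A × E)) W).trace = W.trace :=
  (isCPTP_partialTrace (Equiv.refl (A × E))).tracePreserving W

variable [DecidableEq E]

theorem partialTrace_kronecker_mul_mul (B C : Matrix A A ℂ) (W : Matrix (A × E) (A × E) ℂ) :
    partialTrace (Equiv.refl (A × E)) ((B ⊗ₖ (1 : Matrix E E ℂ)) * W * (C ⊗ₖ (1 : Matrix E E ℂ)))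
      = B * partialTrace (Equiv.refl (A × E)) W * C := by
  ext a a'
  simp only [partialTrace_apply, Matrix.mul_apply, Fintype.sum_prod_type, Matrix.kroneckerMap_apply,
    Matrix.one_apply, mul_ite, ite_mul, mul_one, mul_zero, zero_mul, Finset.sum_ite_eq,
    Finset.sum_ite_eq', Finset.mem_univ, if_true, Equiv.refl_symm, Equiv.refl_apply,
    Finset.mul_sum, Finset.sum_mul]
  rw [Finset.sum_comm]
  refine Finset.sum_congr rfl fun x _ => ?_
  rw [Finset.sum_comm]

variable [DecidableEq A] [DecidableEq M]

/-- If the output `ξ` of a decoder has fidelity `F` with `ρ`, then `ρ` has an extension that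
gives the range of the dilation `V` of the decoder at least the weight `F ^ 2`. The extension is
the dilated output, transported by `B ⊗ 1`; what is missing to `ρ` is added in product form. -/
theorem exists_extension_of_fidelity [Nonempty E] {V : Matrix (A × E) M ℂ} {τ : Matrix M M ℂ}
    (hτ : IsDensity τ) {ρ ξ : Matrix A A ℂ} (hρ : ρ.PosSemidef)
    (hξ : ξ = partialTrace (Equiv.refl (A × E)) (V * τ * V.conjTranspose)) :
    ∃ σ : Matrix (A × E) (A × E) ℂ, σ.PosSemidef ∧ partialTrace (Equiv.refl (A × E)) σ = ρ ∧
      fidelity ρ ξ ^ 2 ≤ (V * V.conjTranspose * σ).trace.re := by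
  have hω : (V * τ * V.conjTranspose).PosSemidef := hτ.1.mul_mul_conjTranspose_same V
  have hξpos : ξ.PosSemidef := hξ ▸ (isCPTP_partialTrace _).posSemidef hω
  obtain ⟨B, hB, hBξ, htr⟩ := exists_transport hρ hξpos
  set F := fidelity ρ ξ with hF
  let e₀ : E := Classical.arbitrary E
  set B' : Matrix (A × E) (A × E) ℂ := B ⊗ₖ (1 : Matrix E E ℂ) with hB'
  have hB'h : B'.IsHermitian := by
    rw [Matrix.IsHermitian, hB', Matrix.conjTranspose_kronecker, hB.eq, Matrix.conjTranspose_one]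
  have hsingle : (Matrix.single e₀ e₀ (1 : ℂ)).PosSemidef := by
    rw [← Matrix.diagonal_single]
    exact Matrix.PosSemidef.diagonal (Pi.single_nonneg.2 zero_le_one)
  have hrest : ((ρ - B * ξ * B) ⊗ₖ Matrix.single e₀ e₀ (1 : ℂ)).PosSemidef := hBξ.kronecker hsingle
  have hmain : (B' * (V * τ * V.conjTranspose) * B').PosSemidef := by
    have := hω.mul_mul_conjTranspose_same B'
    rwa [hB'h.eq] at this
  refine ⟨B' * (V * τ * V.conjTranspose) * B' + (ρ - B * ξ * B) ⊗ₖ Matrix.single e₀ e₀ (1 : ℂ),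
    hmain.add hrest, ?_, ?_⟩
  · have h : partialTrace (Equiv.refl (A × E)) ((ρ - B * ξ * B) ⊗ₖ Matrix.single e₀ e₀ (1 : ℂ))
        = ρ - B * ξ * B := by
      ext a a'
      simp [partialTrace_apply, Matrix.single_apply]
    rw [map_add, partialTrace_kronecker_mul_mul, ← hξ, h, add_sub_cancel]
  · set C : Matrix M M ℂ := V.conjTranspose * B' * V with hC
    have hCh : C.IsHermitian := by
      rw [Matrix.IsHermitian, hC, Matrix.conjTranspose_mul, Matrix.conjTranspose_mul, hB'h.eq,
        Matrix.conjTranspose_conjTranspose, Matrix.mul_assoc]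
    have hCτ : (C * τ).trace = (F : ℂ) := by
      rw [← htr, hξ]
      have h1 := partialTrace_kronecker_mul_mul B 1 (V * τ * V.conjTranspose)
      rw [Matrix.one_kronecker_one, Matrix.mul_one, Matrix.mul_one, ← hB'] at h1
      rw [← h1, trace_partialTrace, hC, Matrix.mul_assoc, Matrix.mul_assoc, Matrix.trace_mul_comm]
      simp only [Matrix.mul_assoc]
    have hτC : (τ * C).trace = (F : ℂ) := by rw [Matrix.trace_mul_comm, hCτ]
    -- Cauchy-Schwarz in the state `τ`: the variance of `C` is nonnegative.
    have hvar : 0 ≤ ((C * τ * C).trace - (F : ℂ) ^ 2).re := by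
      have hh : (C - (F : ℂ) • (1 : Matrix M M ℂ)).IsHermitian := by
        rw [Matrix.IsHermitian, Matrix.conjTranspose_sub, hCh.eq, Matrix.conjTranspose_smul,
          Matrix.conjTranspose_one]
        simp
      have h := (hτ.1.mul_mul_conjTranspose_same (C - (F : ℂ) • (1 : Matrix M M ℂ))).trace_nonneg
      rw [hh.eq] at h
      simp only [Matrix.sub_mul, Matrix.mul_sub, Matrix.smul_mul, Matrix.mul_smul, Matrix.one_mul,
        Matrix.mul_one, Matrix.trace_sub, Matrix.trace_smul, hCτ, hτC, hτ.2, smul_eq_mul] at h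
      convert! (Complex.le_def.1 h).1 using 2
      ring
    have hmainC : (V * V.conjTranspose * (B' * (V * τ * V.conjTranspose) * B')).trace
        = (C * τ * C).trace := by
      rw [Matrix.mul_assoc V, Matrix.trace_mul_comm V, hC]
      simp only [Matrix.mul_assoc]
    have hrestC : 0 ≤ (V * V.conjTranspose *
        ((ρ - B * ξ * B) ⊗ₖ Matrix.single e₀ e₀ (1 : ℂ))).trace.re := by
      rw [Matrix.mul_assoc, Matrix.trace_mul_comm]
      exact (Complex.le_def.1 (hrest.conjTranspose_mul_mul_same V).trace_nonneg).1
    rw [Matrix.mul_add, Matrix.trace_add, Complex.add_re, hmainC]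
    rw [Complex.sub_re, ← Complex.ofReal_pow, Complex.ofReal_re] at hvar
    linarith

end

/-! ### Ensembles and compression schemes -/

section

variable {A X : Type*} [Fintype X] [DecidableEq X]

theorem isDensity_single (x : X) : IsDensity (Matrix.single x x (1 : ℂ)) := by
  refine ⟨?_, by simp⟩
  rw [← Matrix.diagonal_single]
  exact Matrix.PosSemidef.diagonal (Pi.single_nonneg.2 zero_le_one)

theorem cqState_apply (p : X → ℝ) (ρ : X → Matrix A A ℂ) (i j : A × X) :
    cqState p ρ i j = if i.2 = j.2 then (p i.2 : ℂ) * ρ i.2 i.1 j.1 else 0 := by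
  simp only [cqState, Matrix.sum_apply, Matrix.smul_apply, Matrix.kroneckerMap_apply, smul_eq_mul]
  rw [Finset.sum_eq_single i.2]
  · by_cases h : i.2 = j.2 <;> simp [h]
  · intro x _ hx
    simp [hx]
  · simp

theorem posSemidef_cqState [Finite A] {p : X → ℝ} (hp : ∀ x, 0 ≤ p x) {ρ : X → Matrix A A ℂ}
    (hρ : ∀ x, (ρ x).PosSemidef) : (cqState p ρ).PosSemidef :=
  Matrix.posSemidef_sum _ fun x _ =>
    ((hρ x).kronecker (isDensity_single x).1).smul (by exact_mod_cast hp x)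

theorem isDensity_cqState [Fintype A] {p : X → ℝ} (hp : ∀ x, 0 ≤ p x) (hp1 : ∑ x, p x = 1)
    {ρ : X → Matrix A A ℂ} (hρ : ∀ x, IsDensity (ρ x)) : IsDensity (cqState p ρ) := by
  refine ⟨posSemidef_cqState hp fun x => (hρ x).1, ?_⟩
  simp only [cqState, Matrix.trace_sum, Matrix.trace_smul, Matrix.trace_kronecker, (hρ _).2,
    (isDensity_single _).2, smul_eq_mul, mul_one]
  exact_mod_cast hp1

/-- Copies of an ensemble state are the state of the product ensemble. -/
theorem tensorPow_cqState (p : X → ℝ) (ρ : X → Matrix A A ℂ) (n : ℕ) :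
    tensorPow (cqState p ρ) n = cqState (fun x : Fin n → X => ∏ k, p (x k)) (productState ρ) := by
  ext i j
  rw [cqState_apply]
  simp only [tensorPow, Matrix.of_apply, cqState_apply, productState]
  by_cases h : i.2 = j.2
  · simp [h, Finset.prod_mul_distrib]
  · obtain ⟨k, hk⟩ := Function.ne_iff.1 h
    rw [if_neg h]
    exact Finset.prod_eq_zero (Finset.mem_univ k) (if_neg hk)

/-- The one-shot bound: a decoder acting on a space of dimension `|M|` and reaching mean squared
fidelity `t` forces `E_α ≤ log |M| - α / (α - 1) * log t`. -/
theorem renyiEoP_cqState_le [Fintype A] [DecidableEq A] {M : Type*} [Fintype M] [DecidableEq M]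
    {p : X → ℝ} (hp : ∀ x, 0 ≤ p x) (hp1 : ∑ x, p x = 1) {ρ : X → Matrix A A ℂ}
    (hρ : ∀ x, IsDensity (ρ x)) {D : Matrix M M ℂ →ₗ[ℂ] Matrix A A ℂ} (hD : IsCPTP D)
    {τ : X → Matrix M M ℂ} (hτ : ∀ x, IsDensity (τ x)) {α : ℝ} (hα : 1 < α) {t : ℝ} (ht : 0 < t)
    (htF : t ≤ ∑ x, p x * fidelity (ρ x) (D (τ x)) ^ 2) :
    renyiEoP α (cqState p ρ) ≤
      Real.logb 2 (Fintype.card M) - α / (α - 1) * Real.logb 2 t := by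
  have hX : Nonempty X := by
    by_contra h
    rw [not_nonempty_iff] at h
    simp at hp1
  have hA : Nonempty A := (hρ (Classical.arbitrary X)).nonempty
  have hM : Nonempty M := (hτ (Classical.arbitrary X)).nonempty
  obtain ⟨V, hV, hDV⟩ := hD.exists_isometry
  choose σ hσ hσρ hσF using fun x => exists_extension_of_fidelity (hτ x) (hρ x).1 (hDV (τ x))
  let g : A × (M × A) × X → (A × (M × A)) × X := fun i => ((i.1, i.2.1), i.2.2)
  have hext : IsExtension ((cqState p σ).submatrix g g) (cqState p ρ) := by
    refine ⟨(posSemidef_cqState hp hσ).submatrix g, ?_⟩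
    ext i j
    simp only [traceB, Matrix.of_apply, Matrix.submatrix_apply, cqState_apply, g]
    by_cases h : i.2 = j.2
    · simp only [h, if_true, ← Finset.mul_sum, ← hσρ j.2, partialTrace_apply]
      rfl
    · simp [h]
  have htr : traceR ((cqState p σ).submatrix g g) = ∑ x, (p x : ℂ) • σ x := by
    ext i j
    simp [traceR, cqState_apply, g, Matrix.sum_apply]
  have hdens := hext.isDensity_traceR (isDensity_cqState hp hp1 hρ)
  refine (hext.renyiEoP_le (isDensity_cqState hp hp1 hρ) hα).trans ?_
  refine hdens.renyiEntropy_le hα (P := V * V.conjTranspose)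
    (Matrix.posSemidef_self_mul_conjTranspose V) ?_ (by exact_mod_cast Fintype.card_pos) ?_ ht ?_
  · convert! Matrix.posSemidef_self_mul_conjTranspose (1 - V * V.conjTranspose) using 1
    have : V * V.conjTranspose * (V * V.conjTranspose) = V * V.conjTranspose := by
      rw [Matrix.mul_assoc, ← Matrix.mul_assoc _ V, hV, Matrix.one_mul]
    rw [Matrix.conjTranspose_sub, Matrix.conjTranspose_one, Matrix.conjTranspose_mul,
      Matrix.conjTranspose_conjTranspose, Matrix.sub_mul, Matrix.one_mul, Matrix.mul_sub,
      Matrix.mul_one, this, sub_self, sub_zero]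
  · rw [Matrix.trace_mul_comm, hV, Matrix.trace_one]
    simp
  · refine htF.trans ?_
    rw [htr, Matrix.mul_sum, Matrix.trace_sum, Complex.re_sum]
    refine Finset.sum_le_sum fun x _ => ?_
    rw [Matrix.mul_smul, Matrix.trace_smul, smul_eq_mul, Complex.re_ofReal_mul]
    exact mul_le_mul_of_nonneg_left (hσF x) (hp x)

theorem Scheme.renyiEoP_le [Fintype A] [DecidableEq A] {p : X → ℝ} (hp : ∀ x, 0 ≤ p x)
    (hp1 : ∑ x, p x = 1) {ρ : X → Matrix A A ℂ} (hρ : ∀ x, IsDensity (ρ x)) {n : ℕ}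
    (S : Scheme A X n) (hS : 0 < S.avgFidelity p ρ) {α : ℝ} (hα : 1 < α) :
    renyiEoP α (tensorPow (cqState p ρ) n) ≤
      Real.logb 2 S.dimM - 2 * α / (α - 1) * Real.logb 2 (S.avgFidelity p ρ) := by
  have hq : ∀ x : Fin n → X, 0 ≤ ∏ k, p (x k) := fun x => Finset.prod_nonneg fun k _ => hp _
  have hq1 : ∑ x : Fin n → X, ∏ k, p (x k) = 1 := by
    rw [← Fintype.prod_sum (fun (_ : Fin n) x => p x), Finset.prod_eq_one fun _ _ => hp1]
  have hτ : ∀ x : Fin n → X,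
      IsDensity (S.enc (productState ρ x ⊗ₖ Matrix.single x x (1 : ℂ))) := fun x => by
    have h := (IsDensity.productState hρ x).kronecker (isDensity_single x)
    exact ⟨S.enc_cptp.posSemidef h.1, (S.enc_cptp.tracePreserving _).trans h.2⟩
  have h := renyiEoP_cqState_le hq hq1 (IsDensity.productState hρ) S.dec_cptp hτ hα
    (t := S.avgFidelity p ρ ^ 2) (by positivity)
    (Real.pow_arith_mean_le_arith_mean_pow _ _ _ (fun x _ => hq x) hq1
      (fun x _ => fidelity_nonneg _ _) 2)
  rw [tensorPow_cqState]
  refine h.trans_eq ?_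
  rw [Fintype.card_fin, Real.logb_pow]
  push_cast
  ring

/-- The strong converse exponent obtained from the regularization at a fixed order `α`. -/
theorem Scheme.avgFidelity_le [Fintype A] [DecidableEq A] {p : X → ℝ} (hp : ∀ x, 0 ≤ p x)
    (hp1 : ∑ x, p x = 1) {ρ : X → Matrix A A ℂ} (hρ : ∀ x, IsDensity (ρ x)) {n : ℕ} (hn : 1 ≤ n)
    (S : Scheme A X n) {Q : ℝ} (hQ : S.rate ≤ Q) {α : ℝ} (hα : 1 < α) :
    S.avgFidelity p ρ ≤
      (2 : ℝ) ^ (-((n : ℝ) * ((α - 1) / (2 * α) * (regRenyiEoP α (cqState p ρ) - Q)))) := by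
  rcases le_or_gt (S.avgFidelity p ρ) 0 with h0 | h0
  · exact h0.trans (Real.rpow_nonneg zero_le_two _)
  have hn' : (0 : ℝ) < n := by exact_mod_cast hn
  have hα' : 0 < α - 1 := sub_pos.2 hα
  have h1 := regRenyiEoP_le_div (isDensity_cqState hp hp1 hρ) hα (n := n) (by omega)
  rw [le_div_iff₀ hn'] at h1
  have h2 := S.renyiEoP_le hp hp1 hρ h0 hα
  have h3 : Real.logb 2 S.dimM ≤ n * Q := by
    rwa [Scheme.rate, one_div_mul_eq_div, div_le_iff₀' hn'] at hQ
  rw [← Real.logb_le_iff_le_rpow one_lt_two h0]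
  have h4 : 2 * α / (α - 1) * Real.logb 2 (S.avgFidelity p ρ) ≤
      -(n * (regRenyiEoP α (cqState p ρ) - Q)) := by linarith
  rw [div_mul_eq_mul_div, div_le_iff₀ hα'] at h4
  have hα2 : 0 < 2 * α := by linarith
  calc Real.logb 2 (S.avgFidelity p ρ)
      = 2 * α * Real.logb 2 (S.avgFidelity p ρ) / (2 * α) := by field_simp
    _ ≤ -(n * (regRenyiEoP α (cqState p ρ) - Q)) * (α - 1) / (2 * α) := by gcongr
    _ = _ := by ring

end
end VisibleCompression

theorem mainTheorem4 {A X : Type*} [Fintype A] [DecidableEq A] [Fintype X] [DecidableEq X]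
    (p : X → ℝ) (hp_nonneg : ∀ x, 0 ≤ p x) (hp_sum : ∑ x, p x = 1)
    (ρ : X → Matrix A A ℂ) (hρ : ∀ x, VisibleCompression.IsDensity (ρ x)) :
    (∀ α : ℝ, 1 < α →
      Tendsto (fun n : ℕ => VisibleCompression.renyiEoP α
          (VisibleCompression.tensorPow (VisibleCompression.cqState p ρ) n) / (n : ℝ))
        atTop (𝓝 (VisibleCompression.regRenyiEoP α (VisibleCompression.cqState p ρ)))) ∧
    ∃ L : ℝ,
      Tendsto (fun α : ℝ => VisibleCompression.regRenyiEoP α (VisibleCompression.cqState p ρ))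
        (𝓝[>] 1) (𝓝 L) ∧
      ∀ Q : ℝ, Q < L → ∃ K : ℝ, 0 < K ∧
        ∀ n : ℕ, 1 ≤ n → ∀ S : VisibleCompression.Scheme A X n, S.rate ≤ Q →
          S.avgFidelity p ρ ≤ (2 : ℝ) ^ (-((n : ℝ) * K)) := by
  have hd := VisibleCompression.isDensity_cqState hp_nonneg hp_sum hρ
  have hlim := VisibleCompression.tendsto_regRenyiEoP_nhdsGT hd
  refine ⟨fun α hα => VisibleCompression.tendsto_regRenyiEoP hd hα, _, hlim, fun Q hQ => ?_⟩
  -- Close to `α = 1` the regularization already exceeds the rate.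
  obtain ⟨α, hαQ, hα⟩ := ((hlim.eventually_const_lt hQ).and self_mem_nhdsWithin).exists
  have hα0 : 0 < α := zero_lt_one.trans hα
  refine ⟨(α - 1) / (2 * α) * (VisibleCompression.regRenyiEoP α
    (VisibleCompression.cqState p ρ) - Q), ?_, fun n hn S hS => ?_⟩
  · exact mul_pos (div_pos (sub_pos.2 hα) (by positivity)) (sub_pos.2 hαQ)
  · exact S.avgFidelity_le hp_nonneg hp_sum hρ hn hS hα
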